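/- Let $\mathcal H$ be a real Hilbert space, let $A:\mathcal H\rightrightarrows\mathcal H$ be a maximally monotone operator, let $\beta>0$, and let $B:\mathcal H\to\mathcal H$ be monotone and $\frac1\beta$-Lipschitz continuous. Assume that $\operatorname{zer}(A+B)=\{x\in\mathcal H : 0\in Ax+Bx\}$ is nonempty. Let $\gamma:[0,+\infty)\to\mathbb R$ be locally absolutely continuous (that is, absolutely continuous on $[0,b]$ for every $b>0$) such that, for some $\delta,\varepsilon>0$, $\delta\le\gamma(t)\le\beta-\varepsilon$ for all $t\in[0,+\infty)$, and such that $\dot\gamma\in L^\infty([0,+\infty))$. Let $x_0\in\mathcal H$ and let $x,z:[0,+\infty)\to\mathcal H$ be the trajectories of the dynamical system $$\left\{\begin{aligned} z(t)&=J_{\gamma(t)A}\bigl(x(t)-\gamma(t)Bx(t)\bigr),\\ 0&=\dot x(t)+x(t)-z(t)-\gamma(t)Bx(t)+\gamma(t)Bz(t),\\ x(0)&=x_0,\end{aligned}\right.$$ where $J_{\lambda A}=(\mathrm{Id}+\lambda A)^{-1}$ is the resolvent; that is, $x$ is locally absolutely continuous, the first equation holds for every $t\ge 0$, the second for almost every $t\ge0$,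 and $x(0)=x_0$. Then there exists $w\in\operatorname{zer}(A+B)$ such that both $x(t)$ and $z(t)$ converge weakly to $w$ as $t\to+\infty$. -/

import Mathlib

open MeasureTheory Filter Topology

/-- A set-valued operator `M : H ⇉ H` maps points of `H` to subsets of `H`. -/
abbrev SetValuedOp (H : Type*) := H → Set H

namespace SetValuedOp

variable {H : Type*} [NormedAddCommGroup H] [InnerProductSpace ℝ H]

/-- A single-valued operator regarded as a set-valued one. -/
def ofFun (B : H → H) : SetValuedOp H := fun x => {B x}

/-- The zeros of `M`. -/
def zer (M : SetValuedOp H) : Set H := {x | 0 ∈ M x}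

/-- The Minkowski sum of two operators. -/
def sum (M N : SetValuedOp H) : SetValuedOp H :=
  fun x => {u | ∃ a ∈ M x, ∃ b ∈ N x, u = a + b}

/-- The scalar multiple of an operator. -/
def scale (c : ℝ) (M : SetValuedOp H) : SetValuedOp H :=
  fun x => {u | ∃ y ∈ M x, u = c • y}

/-- The inverse operator. -/
def inverse (M : SetValuedOp H) : SetValuedOp H := fun y => {x | y ∈ M x}

/-- The resolvent `(Id + c M)⁻¹`, as a set-valued operator.  When `M` is maximally monotone and
`c > 0`, each of its values is a singleton. -/
def resolvent (c : ℝ) (M : SetValuedOp H) : SetValuedOp H :=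
  inverse (sum (ofFun id) (scale c M))

/-- Monotone operators. -/
def IsMonotone (M : SetValuedOp H) : Prop :=
  ∀ x y : H, ∀ u ∈ M x, ∀ v ∈ M y, 0 ≤ inner ℝ (x - y) (u - v)

/-- Maximally monotone operators: no monotone operator has a strictly larger graph. -/
def IsMaximallyMonotone (M : SetValuedOp H) : Prop :=
  IsMonotone M ∧ ∀ N : SetValuedOp H, IsMonotone N → (∀ x, M x ⊆ N x) → N = M

end SetValuedOp

/-- `f : [0, ∞) → X` is locally absolutely continuous: it is absolutely continuous on each interval
`[0, b]`.  The values of `f` at negative arguments are irrelevant. -/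
def IsLocallyAbsolutelyContinuous {X : Type*} [PseudoMetricSpace X] (f : ℝ → X) : Prop :=
  ∀ b : ℝ, 0 < b → AbsolutelyContinuousOnInterval f 0 b

/-- `x` is a strong global solution, with companion trajectory `z`, on `[0, ∞)` of
`z(t) = J_{γ(t) A} (x(t) - γ(t) B x(t))`,
`0 = x'(t) + x(t) - z(t) - γ(t) B x(t) + γ(t) B z(t)`, `x(0) = x₀`. -/
structure IsStrongGlobalSolution {H : Type*} [NormedAddCommGroup H] [InnerProductSpace ℝ H]
    (A : SetValuedOp H) (B : H → H) (γ : ℝ → ℝ) (x₀ : H) (x z : ℝ → H) : Prop where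
  locallyAC : IsLocallyAbsolutelyContinuous x
  resolvent_eq : ∀ t : ℝ, 0 ≤ t →
    SetValuedOp.resolvent (γ t) A (x t - γ t • B (x t)) = {z t}
  equation : ∀ᵐ t ∂(volume.restrict (Set.Ici (0 : ℝ))),
    ∃ v : H, HasDerivAt x v t ∧ v + x t - z t - γ t • B (x t) + γ t • B (z t) = 0
  initial : x 0 = x₀

/-- Weak convergence of `f(t)` to `w` as `t → +∞`. -/
def ConvergesWeakly {H : Type*} [NormedAddCommGroup H] [InnerProductSpace ℝ H]
    (f : ℝ → H) (w : H) : Prop :=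
  Tendsto (fun t => toWeakSpace ℝ H (f t)) atTop (𝓝 (toWeakSpace ℝ H w))

/-! ### Absolutely continuous functions -/

/-! For a zero `w`, the function `‖x t - w‖ ^ 2` is a Lyapunov function. Monotonicity of `A` and `B`
at `w` gives `⟨z - w, x'⟩ ≤ 0`, and the Lipschitz bound with `γ ≤ β - ε` gives `⟨x - z, x'⟩ ≤
-(ε/β)‖x - z‖²`. So `‖x - w‖` decreases and has a limit.

Since `γ` is Lipschitz, so are `x` and `z`, and a Barbalat argument turns the dissipation into `‖x -
z‖ → 0`. Because `γ ≥ δ`, the residual `u + B z` with `u ∈ A z` then tends to zero. Weak-strong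
closedness makes every weak cluster point a zero, and Opial's lemma shows that there is only one.
Cluster points are taken along ultrafilters. -/

theorem LipschitzWith.comp_absolutelyContinuousOnInterval {X Y : Type*} [PseudoMetricSpace X]
    [PseudoMetricSpace Y] {g : X → Y} {K : NNReal} (hg : LipschitzWith K g) {f : ℝ → X} {a b : ℝ}
    (hf : AbsolutelyContinuousOnInterval f a b) :
    AbsolutelyContinuousOnInterval (fun t => g (f t)) a b := by
  unfold AbsolutelyContinuousOnInterval at hf ⊢
  refine squeeze_zero (fun t => Finset.sum_nonneg fun i _ => dist_nonneg) (fun t => ?_)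
    (by simpa using hf.const_mul (K : ℝ))
  rw [Finset.mul_sum]
  exact Finset.sum_le_sum fun i _ => hg.dist_le_mul _ _

theorem AbsolutelyContinuousOnInterval.sub_le_of_ae_deriv_le {f : ℝ → ℝ} {s t c : ℝ}
    (hst : s ≤ t) (hf : AbsolutelyContinuousOnInterval f s t)
    (hd : ∀ᵐ r, r ∈ Set.Icc s t → deriv f r ≤ c) : f t - f s ≤ c * (t - s) := by
  rw [← hf.integral_deriv_eq_sub]
  calc ∫ r in s..t, deriv f r ≤ ∫ _ in s..t, c := by
        refine intervalIntegral.integral_mono_ae_restrict hst hf.intervalIntegrable_deriv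
          intervalIntegrable_const ?_
        exact (ae_restrict_iff' measurableSet_Icc).2 hd
    _ = c * (t - s) := by simp [mul_comm]

namespace IsLocallyAbsolutelyContinuous

theorem absolutelyContinuousOnInterval {X : Type*} [PseudoMetricSpace X] {f : ℝ → X}
    (hf : IsLocallyAbsolutelyContinuous f) {s t : ℝ} (hs : 0 ≤ s) (hst : s ≤ t) :
    AbsolutelyContinuousOnInterval f s t := by
  refine (hf (t + 1) (by linarith)).mono ?_
  rw [Set.uIcc_of_le hst, Set.uIcc_of_le (by linarith)]
  exact Set.Icc_subset_Icc hs (by linarith)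

theorem norm_sub_sq {E : Type*} [NormedAddCommGroup E] {f : ℝ → E} (hf : IsLocallyAbsolutelyContinuous f) (w : E) :
    IsLocallyAbsolutelyContinuous fun t => ‖f t - w‖ ^ 2 := by
  intro b hb
  have h1 : LipschitzWith 1 fun y : E => ‖y - w‖ := by
    refine LipschitzWith.of_dist_le_mul fun y y' => ?_
    rw [Real.dist_eq, dist_eq_norm]
    simpa using abs_norm_sub_norm_le (y - w) (y' - w)
  have h2 := h1.comp_absolutelyContinuousOnInterval (hf b hb)
  simpa only [sq] using h2.fun_mul h2

theorem antitoneOn_of_ae_deriv_nonpos {g : ℝ → ℝ} (hg : IsLocallyAbsolutelyContinuous g)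
    (hd : ∀ᵐ t, 0 ≤ t → deriv g t ≤ 0) : AntitoneOn g (Set.Ici 0) := by
  intro s hs t _ hst
  have := (hg.absolutelyContinuousOnInterval hs hst).sub_le_of_ae_deriv_le (c := 0) hst (by
    filter_upwards [hd] with r hr hrs using hr (le_trans hs hrs.1))
  linarith

theorem exists_tendsto_of_ae_deriv_nonpos {g : ℝ → ℝ} (hg : IsLocallyAbsolutelyContinuous g)
    (hg0 : ∀ t, 0 ≤ g t) (hd : ∀ᵐ t, 0 ≤ t → deriv g t ≤ 0) : ∃ l, Tendsto g atTop (𝓝 l) := by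
  have h1 : Antitone fun t => g (max t 0) := fun s t hst =>
    hg.antitoneOn_of_ae_deriv_nonpos hd (le_max_right s 0) (le_max_right t 0)
      (max_le_max_right 0 hst)
  refine ⟨_, (tendsto_atTop_ciInf h1 ⟨0, ?_⟩).congr' ?_⟩
  · rintro _ ⟨t, rfl⟩
    exact hg0 _
  · filter_upwards [eventually_ge_atTop 0] with t ht
    rw [max_eq_left ht]

variable {H : Type*} [NormedAddCommGroup H] [InnerProductSpace ℝ H]

/-- Pairing `f` with the fixed vector `f t - f s` reduces the bound to the real-valued fundamental
theorem of calculus. -/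
theorem norm_sub_le_of_ae_hasDerivAt {f : ℝ → H} (hf : IsLocallyAbsolutelyContinuous f) {C : ℝ}
    {s t : ℝ} (hs : 0 ≤ s) (hst : s ≤ t)
    (hd : ∀ᵐ r, r ∈ Set.Icc s t → ∃ v, HasDerivAt f v r ∧ ‖v‖ ≤ C) :
    ‖f t - f s‖ ≤ C * (t - s) := by
  set d := f t - f s
  have hac : AbsolutelyContinuousOnInterval (fun r => inner ℝ d (f r)) s t :=
    (innerSL ℝ d).lipschitz.comp_absolutelyContinuousOnInterval
      (hf.absolutelyContinuousOnInterval hs hst)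
  have key := hac.sub_le_of_ae_deriv_le (c := ‖d‖ * C) hst (by
    filter_upwards [hd] with r hr hrs
    obtain ⟨v, hv, hvC⟩ := hr hrs
    have h1 : HasDerivAt (fun r => inner ℝ d (f r)) (inner ℝ d v) r := by
      simpa using (hasDerivAt_const r d).inner ℝ hv
    rw [h1.deriv]
    exact (real_inner_le_norm d v).trans (by gcongr))
  have h2 : inner ℝ d (f t) - inner ℝ d (f s) = ‖d‖ * ‖d‖ := by
    rw [← inner_sub_right, real_inner_self_eq_norm_mul_norm]
  simp only [h2] at key
  rcases (norm_nonneg d).eq_or_lt with h0 | h0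
  -- `C` is not assumed nonnegative: when `s < t`, the interval has positive measure and so contains
  -- a point where `‖v‖ ≤ C`.
  · have : (0 : ℝ) ≤ C * (t - s) := by
      rcases hst.eq_or_lt with h | h
      · simp [h]
      · obtain ⟨r, hr, hrs⟩ : ∃ r, r ∈ Set.Icc s t ∧ ∃ v, HasDerivAt f v r ∧ ‖v‖ ≤ C := by
          by_contra hcon
          push Not at hcon
          have : volume (Set.Icc s t) = 0 := by
            refine measure_mono_null (fun r hr => ?_) hd
            simp only [Set.mem_compl_iff, Set.mem_ofPred_eq]
            intro h'
            obtain ⟨v, hv, hvC⟩ := h' hr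
            exact absurd hvC (not_le.2 (hcon r hr v hv))
          rw [Real.volume_Icc, ENNReal.ofReal_eq_zero] at this
          linarith
        obtain ⟨v, -, hv⟩ := hrs
        exact mul_nonneg ((norm_nonneg v).trans hv) (by linarith)
    linarith
  · nlinarith

end IsLocallyAbsolutelyContinuous

/-- A Barbalat-type lemma. -/
theorem tendsto_zero_of_ae_deriv_le_neg_sq {g e : ℝ → ℝ} {c L : ℝ} (hc : 0 < c) (hL : 0 < L)
    (hg : IsLocallyAbsolutelyContinuous g) (hg0 : ∀ t, 0 ≤ g t) (he0 : ∀ t, 0 ≤ e t)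
    (he : ∀ s t, 0 ≤ s → s ≤ t → e s - e t ≤ L * (t - s))
    (hd : ∀ᵐ t, 0 ≤ t → deriv g t ≤ -c * e t ^ 2) : Tendsto e atTop (𝓝 0) := by
  obtain ⟨l, hl⟩ := hg.exists_tendsto_of_ae_deriv_nonpos hg0 (by
    filter_upwards [hd] with r hr hr0
    exact (hr hr0).trans (by nlinarith [mul_nonneg hc.le (sq_nonneg (e r))]))
  rw [Metric.tendsto_atTop]
  intro η hη
  -- If `e t ≥ η`, then `e ≥ η / 2` on `[t, t + τ]`, so `g` drops there by at least `c (η / 2)² τ`;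
  -- convergence of `g` forbids this for large `t`.
  set τ := η / (2 * L) with hτ
  have hτ0 : 0 < τ := by positivity
  have hLτ : L * τ = η / 2 := by rw [hτ]; field_simp
  have hlim : Tendsto (fun t => g (t + τ) - g t) atTop (𝓝 0) := by
    simpa using (hl.comp (tendsto_atTop_add_const_right _ τ tendsto_id)).sub hl
  have hneg : -c * (η / 2) ^ 2 * τ < 0 := by
    have : 0 < c * (η / 2) ^ 2 * τ := by positivity
    linarith
  obtain ⟨N, hN⟩ := eventually_atTop.1 (hlim.eventually (lt_mem_nhds hneg))
  refine ⟨max N 0, fun t ht => ?_⟩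
  have ht0 : 0 ≤ t := (le_max_right _ _).trans ht
  rw [Real.dist_eq, sub_zero, abs_of_nonneg (he0 t)]
  by_contra! hcon
  have hle : t ≤ t + τ := by linarith
  have := (hg.absolutelyContinuousOnInterval ht0 hle).sub_le_of_ae_deriv_le
    (c := -c * (η / 2) ^ 2) hle (by
      filter_upwards [hd] with r hr hrs
      refine (hr (ht0.trans hrs.1)).trans ?_
      have h1 := he t r ht0 hrs.1
      have h2 : L * (r - t) ≤ L * τ := by
        gcongr
        linarith [hrs.2]
      have h3 : (η / 2) ^ 2 ≤ e r ^ 2 := by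
        gcongr
        linarith
      nlinarith)
  have h4 := hN t ((le_max_left _ _).trans ht)
  rw [add_sub_cancel_left] at this
  linarith

/-! ### Weak limits along ultrafilters -/

section Weak

variable {H : Type*} [NormedAddCommGroup H] [InnerProductSpace ℝ H] {ι : Type*}

theorem Ultrafilter.exists_tendsto_of_abs_le (U : Ultrafilter ι) {f : ι → ℝ} {C : ℝ}
    (hf : ∀ᶠ i in (U : Filter ι), |f i| ≤ C) : ∃ l, Tendsto f U (𝓝 l) := by
  have := (isCompact_Icc (a := -C) (b := C)).ultrafilter_le_nhds (U.map f) (by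
    rw [le_principal_iff, Ultrafilter.coe_map, Filter.mem_map]
    filter_upwards [hf] with i hi using abs_le.1 hi)
  obtain ⟨l, -, hl⟩ := this
  exact ⟨l, hl⟩

/-- The scalar limits along `U` form a bounded linear functional, which the Riesz theorem
represents. -/
theorem Ultrafilter.exists_tendsto_inner [CompleteSpace H] (U : Ultrafilter ι) {f : ι → H} {C : ℝ}
    (hf : ∀ᶠ i in (U : Filter ι), ‖f i‖ ≤ C) :
    ∃ w : H, ∀ v, Tendsto (fun i => inner ℝ (f i) v) U (𝓝 (inner ℝ w v)) := by
  have h1 : ∀ v, ∃ l, Tendsto (fun i => inner ℝ (f i) v) U (𝓝 l) := fun v =>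
    U.exists_tendsto_of_abs_le (C := C * ‖v‖) (by
      filter_upwards [hf] with i hi
      exact (abs_real_inner_le_norm _ _).trans (by gcongr))
  choose φ hφ using h1
  let ψ : H →ₗ[ℝ] ℝ :=
    { toFun := φ
      map_add' := fun v v' => tendsto_nhds_unique (hφ (v + v'))
        (((hφ v).add (hφ v')).congr fun i => (inner_add_right _ _ _).symm)
      map_smul' := fun a v => tendsto_nhds_unique (hφ (a • v))
        (((hφ v).const_mul a).congr fun i => (real_inner_smul_right _ _ _).symm) }
  have hb : ∀ v, ‖ψ v‖ ≤ C * ‖v‖ := fun v => by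
    refine le_of_tendsto (hφ v).norm ?_
    filter_upwards [hf] with i hi
    exact (norm_inner_le_norm _ _).trans (by gcongr)
  refine ⟨(InnerProductSpace.toDual ℝ H).symm (ψ.mkContinuous C hb), fun v => ?_⟩
  rw [InnerProductSpace.toDual_symm_apply]
  exact hφ v

theorem convergesWeakly_iff_inner [CompleteSpace H] {f : ℝ → H} {w : H} :
    ConvergesWeakly f w ↔ ∀ v, Tendsto (fun t => inner ℝ (f t) v) atTop (𝓝 (inner ℝ w v)) := by
  have hinj : Function.Injective ((topDualPairing ℝ H).flip) := by
    intro a b hab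
    refine ext_inner_right ℝ fun v => ?_
    have := LinearMap.congr_fun hab (InnerProductSpace.toDual ℝ H v)
    simpa [real_inner_comm] using! this
  unfold ConvergesWeakly
  refine Iff.trans (WeakBilin.tendsto_iff_forall_eval_tendsto _ hinj) ⟨fun h v => ?_, fun h y => ?_⟩
  · simp_rw [real_inner_comm v]
    exact h (InnerProductSpace.toDual ℝ H v)
  · obtain ⟨v, rfl⟩ := (InnerProductSpace.toDual ℝ H).surjective y
    have := h v
    simp_rw [real_inner_comm v] at this
    exact this

end Weak

/-! ### Monotone operators -/

section Operators

namespace SetValuedOp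

theorem mem_zer_sum_ofFun_iff {E : Type*} [NormedAddCommGroup E]
    {A : SetValuedOp E} {B : E → E} {w : E} : w ∈ zer (sum A (ofFun B)) ↔ -B w ∈ A w := by
  constructor
  · rintro ⟨a, ha, b, rfl, hab⟩
    rwa [← eq_neg_of_add_eq_zero_left hab.symm]
  · intro h
    exact ⟨_, h, _, rfl, by simp⟩

variable {H : Type*} [NormedAddCommGroup H] [InnerProductSpace ℝ H] {A : SetValuedOp H} {B : H → H}

theorem mem_resolvent_iff {c : ℝ} {p y : H} :
    p ∈ resolvent c A y ↔ ∃ u ∈ A p, y = p + c • u := by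
  simp [resolvent, inverse, sum, scale, ofFun]

theorem IsMonotone.inner_ofFun_nonneg (hB : IsMonotone (ofFun B)) (x y : H) :
    0 ≤ inner ℝ (x - y) (B x - B y) :=
  hB x y _ rfl _ rfl

/-- Adjoining `(w, a)` to the graph keeps it monotone, so maximality says it was already there. -/
theorem IsMaximallyMonotone.mem_of_forall (hA : IsMaximallyMonotone A) {w a : H}
    (h : ∀ y, ∀ u ∈ A y, 0 ≤ inner ℝ (w - y) (a - u)) : a ∈ A w := by
  have hN : IsMonotone fun y => A y ∪ {u | y = w ∧ u = a} := by
    rintro x y u (hu | ⟨rfl, rfl⟩) v (hv | ⟨rfl, rfl⟩)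
    · exact hA.1 x y u hu v hv
    · have := h x u hu
      rwa [← neg_sub x, ← neg_sub u, inner_neg_neg] at this
    · exact h y v hv
    · simp
  have := hA.2 _ hN fun y => Set.subset_union_left
  rw [← this]
  exact Or.inr ⟨rfl, rfl⟩

/-- Weak-strong closedness at `0` of the graph of the sum of a maximally monotone operator and a
Lipschitz monotone one, along an ultrafilter. -/
theorem IsMaximallyMonotone.neg_mem_of_tendsto [CompleteSpace H] (hA : IsMaximallyMonotone A)
    (hB : IsMonotone (ofFun B)) {β : ℝ} (hβ : 0 < β)
    (hBlip : ∀ x y : H, ‖B x - B y‖ ≤ 1 / β * ‖x - y‖)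
    {ι : Type*} (U : Ultrafilter ι) {z u : ι → H} {w : H} {C : ℝ}
    (hu : ∀ᶠ i in (U : Filter ι), u i ∈ A (z i)) (hz : ∀ᶠ i in (U : Filter ι), ‖z i‖ ≤ C)
    (hw : ∀ v, Tendsto (fun i => inner ℝ (z i) v) U (𝓝 (inner ℝ w v)))
    (hr : Tendsto (fun i => u i + B (z i)) U (𝓝 0)) : -B w ∈ A w := by
  have hBz : ∀ᶠ i in (U : Filter ι), ‖B (z i)‖ ≤ 1 / β * C + ‖B 0‖ := by
    filter_upwards [hz] with i hi
    have h1 := hBlip (z i) 0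
    rw [sub_zero] at h1
    have h2 : 1 / β * ‖z i‖ ≤ 1 / β * C := by gcongr
    linarith [norm_le_norm_sub_add (B (z i)) (B 0)]
  -- A priori neither `b = B w` nor `L = ⟨w, b⟩` is known. Monotonicity of `B` gives `L ≥ ⟨w, b⟩`,
  -- hence `-b ∈ A w`; testing `A` against that pair gives the reverse inequality.
  obtain ⟨b, hb⟩ := U.exists_tendsto_inner hBz
  obtain ⟨L, hL⟩ := U.exists_tendsto_of_abs_le (f := fun i => inner ℝ (z i) (B (z i)))
    (C := C * (1 / β * C + ‖B 0‖)) (by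
      filter_upwards [hz, hBz] with i h1 h2
      refine (abs_real_inner_le_norm _ _).trans ?_
      exact mul_le_mul h1 h2 (norm_nonneg _) ((norm_nonneg _).trans h1))
  have hBlim : ∀ y, 0 ≤ L - inner ℝ w (B y) - (inner ℝ b y - inner ℝ y (B y)) := fun y => by
    refine ge_of_tendsto' ((hL.sub (hw (B y))).sub ((hb y).sub_const _)) fun i => ?_
    have := hB.inner_ofFun_nonneg (z i) y
    rw [inner_sub_left, inner_sub_right, inner_sub_right] at this
    rwa [real_inner_comm y]
  have hr' : Tendsto (fun i => inner ℝ (z i) (u i + B (z i))) U (𝓝 0) := by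
    refine squeeze_zero_norm' (a := fun i => C * ‖u i + B (z i)‖) ?_ ?_
    · filter_upwards [hz] with i hi
      exact (norm_inner_le_norm _ _).trans (by gcongr)
    · simpa using hr.norm.const_mul C
  have hAlim : ∀ y, ∀ a ∈ A y, 0 ≤ inner ℝ b y - L - inner ℝ w a + inner ℝ y a := fun y a ha => by
    have h1 : Tendsto (fun i => inner ℝ y (u i + B (z i))) U (𝓝 0) := by
      simpa using (tendsto_const_nhds (x := y)).inner (𝕜 := ℝ) hr
    have h2 := (((hr'.sub h1).add ((hb y).sub hL)).sub (hw a)).add_const (inner ℝ y a)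
    simp only [sub_zero, zero_add] at h2
    refine ge_of_tendsto h2 ?_
    filter_upwards [hu] with i hi
    have := hA.1 _ _ _ hi _ ha
    simp only [inner_sub_left, inner_sub_right, inner_add_right] at this ⊢
    rw [real_inner_comm y]
    linarith
  have hLb : inner ℝ w b ≤ L := by
    have := hBlim w
    rw [real_inner_comm w] at this
    linarith
  have hbA : -b ∈ A w := hA.mem_of_forall fun y a ha => by
    have := hAlim y a ha
    rw [real_inner_comm y] at this
    simp only [inner_sub_left, inner_sub_right, inner_neg_right]
    linarith
  have hLe : L = inner ℝ w b := by
    have := hAlim w _ hbA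
    rw [inner_neg_right, real_inner_comm w] at this
    linarith
  have hB' : ∀ y, 0 ≤ inner ℝ (w - y) (b - B y) := fun y => by
    have := hBlim y
    rw [hLe, real_inner_comm y] at this
    simp only [inner_sub_left, inner_sub_right]
    linarith
  -- Minty's trick: testing at `w - (β / 2) • v` yields `‖v‖² ≤ ‖v‖² / 2`.
  have hbB : B w - b = 0 := by
    set v := B w - b with hv
    have h1 := hB' (w - (β / 2) • v)
    rw [sub_sub_cancel, real_inner_smul_left] at h1
    have h2 : 0 ≤ inner ℝ v (b - B (w - (β / 2) • v)) :=
      nonneg_of_mul_nonneg_right h1 (by positivity)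
    have h3 : b - B (w - (β / 2) • v) = (B w - B (w - (β / 2) • v)) - v := by
      rw [hv]; abel
    have h4 : ‖B w - B (w - (β / 2) • v)‖ ≤ ‖v‖ / 2 := by
      refine (hBlip _ _).trans (le_of_eq ?_)
      rw [sub_sub_cancel, norm_smul, Real.norm_of_nonneg (by positivity)]
      field_simp
    rw [h3, inner_sub_right, real_inner_self_eq_norm_sq] at h2
    have h5 := real_inner_le_norm v (B w - B (w - (β / 2) • v))
    have h6 : ‖v‖ * ‖B w - B (w - (β / 2) • v)‖ ≤ ‖v‖ * (‖v‖ / 2) := by gcongr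
    have h7 : ‖v‖ ^ 2 ≤ 0 := by nlinarith
    exact norm_eq_zero.1 (pow_eq_zero_iff two_ne_zero |>.1 (le_antisymm h7 (sq_nonneg _)))
  rwa [sub_eq_zero.1 hbB]

/-- The fundamental inequality of the forward-backward-forward splitting. -/
theorem IsMonotone.inner_forwardBackwardForward_le (hA : IsMonotone A) (hB : IsMonotone (ofFun B))
    {β : ℝ} (hβ : 0 < β) (hBlip : ∀ x y : H, ‖B x - B y‖ ≤ 1 / β * ‖x - y‖)
    {c ε : ℝ} (hc : 0 ≤ c) (hcβ : c ≤ β - ε) {x z u w : H} (hu : u ∈ A z)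
    (hx : x - c • B x = z + c • u) (hw : -B w ∈ A w) :
    inner ℝ (x - w) (z - x + c • B x - c • B z) ≤ -(ε / β) * ‖x - z‖ ^ 2 := by
  set d := z - x + c • B x - c • B z with hd
  have h1 : 0 ≤ inner ℝ (z - w) (u + B w) := by
    simpa using hA _ _ _ hu _ hw
  have h2 := hB.inner_ofFun_nonneg z w
  have h3 : d = -(c • ((u + B w) + (B z - B w))) := by
    have : c • u = x - c • B x - z := by rw [hx]; abel
    rw [hd]
    simp only [smul_add, smul_sub, this]
    abel
  have h4 : inner ℝ (z - w) d ≤ 0 := by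
    rw [h3, inner_neg_right, real_inner_smul_right, inner_add_right]
    have := mul_nonneg hc (add_nonneg h1 h2)
    linarith
  have h5 : inner ℝ (x - w) d = inner ℝ (z - w) d + inner ℝ (x - z) d := by
    rw [← inner_add_left]; congr 1; abel
  have h6 : d = c • (B x - B z) - (x - z) := by
    rw [hd, smul_sub]; abel
  have h7 : inner ℝ (x - z) d ≤ c / β * ‖x - z‖ ^ 2 - ‖x - z‖ ^ 2 := by
    rw [h6, inner_sub_right, real_inner_smul_right, real_inner_self_eq_norm_sq]
    have h8 := (real_inner_le_norm (x - z) (B x - B z)).trans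
      (mul_le_mul_of_nonneg_left (hBlip x z) (norm_nonneg _))
    have h9 := mul_le_mul_of_nonneg_left h8 hc
    have : c * (‖x - z‖ * (1 / β * ‖x - z‖)) = c / β * ‖x - z‖ ^ 2 := by ring
    linarith
  have h10 : c / β ≤ 1 - ε / β := by
    rw [div_le_iff₀ hβ]
    have : (1 - ε / β) * β = β - ε := by field_simp
    linarith
  have h11 := mul_le_mul_of_nonneg_right h10 (sq_nonneg ‖x - z‖)
  nlinarith

/-- Resolvents are nonexpansive, and a change of parameter only shifts the argument by `(c' - c) •
u'`. -/
theorem IsMonotone.norm_sub_le_of_add_smul (hA : IsMonotone A) {c c' : ℝ} (hc : 0 ≤ c)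
    {p p' u u' y y' : H} (hu : u ∈ A p) (hu' : u' ∈ A p') (hy : y = p + c • u)
    (hy' : y' = p' + c' • u') : ‖p - p'‖ ≤ ‖y - y'‖ + |c' - c| * ‖u'‖ := by
  have h1 := mul_nonneg hc (hA _ _ _ hu _ hu')
  have h2 : c • (u - u') = ((y - y') + (c' - c) • u') - (p - p') := by
    rw [hy, hy', sub_smul, smul_sub]; abel
  rw [← real_inner_smul_right, h2, inner_sub_right, real_inner_self_eq_norm_sq] at h1
  have h3 := real_inner_le_norm (p - p') ((y - y') + (c' - c) • u')
  have h4 : ‖(y - y') + (c' - c) • u'‖ ≤ ‖y - y'‖ + |c' - c| * ‖u'‖ := by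
    refine (norm_add_le _ _).trans ?_
    rw [norm_smul, Real.norm_eq_abs]
  have h5 := mul_le_mul_of_nonneg_left h4 (norm_nonneg (p - p'))
  rcases (norm_nonneg (p - p')).eq_or_lt with h0 | h0
  · rw [← h0]; positivity
  · nlinarith

end SetValuedOp

end Operators
-- Opial's lemma and convergence of the trajectories
theorem IsLocallyAbsolutelyContinuous.exists_abs_sub_le_of_memLp_top {γ : ℝ → ℝ}
    (hγ : IsLocallyAbsolutelyContinuous γ)
    (hγ' : MemLp (deriv γ) ⊤ (volume.restrict (Set.Ici (0 : ℝ)))) :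
    ∃ M, 0 ≤ M ∧ ∀ s t, 0 ≤ s → s ≤ t → |γ t - γ s| ≤ M * (t - s) := by
  refine ⟨(eLpNorm (deriv γ) ⊤ (volume.restrict (Set.Ici (0 : ℝ)))).toReal,
    ENNReal.toReal_nonneg, fun s t hs hst => ?_⟩
  have h1 : ∀ᵐ r, r ∈ Set.Ici (0 : ℝ) → ‖deriv γ r‖ ≤
      (eLpNorm (deriv γ) ⊤ (volume.restrict (Set.Ici (0 : ℝ)))).toReal := by
    refine (ae_restrict_iff' measurableSet_Ici).1 ?_
    have h2 := ae_le_eLpNormEssSup (f := deriv γ) (μ := volume.restrict (Set.Ici (0 : ℝ)))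
    rw [← eLpNorm_exponent_top] at h2
    filter_upwards [h2] with r hr
    rw [← toReal_enorm]
    exact ENNReal.toReal_mono hγ'.2.ne hr
  refine hγ.norm_sub_le_of_ae_hasDerivAt hs hst ?_
  filter_upwards [h1, (hγ.absolutelyContinuousOnInterval hs hst).ae_differentiableAt]
    with r hr hr' hrs
  exact ⟨_, (hr' (by rwa [Set.uIcc_of_le hst])).hasDerivAt, hr (hs.trans hrs.1)⟩

/-- A form of Opial's lemma. -/
theorem exists_convergesWeakly_of_tendsto_norm_sub {H : Type*} [NormedAddCommGroup H]
    [InnerProductSpace ℝ H] [CompleteSpace H] {S : Set H} {x : ℝ → H} {C : ℝ}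
    (hC : ∀ᶠ t in atTop, ‖x t‖ ≤ C)
    (hlim : ∀ w ∈ S, ∃ l, Tendsto (fun t => ‖x t - w‖ ^ 2) atTop (𝓝 l))
    (hS : ∀ U : Ultrafilter ℝ, (U : Filter ℝ) ≤ atTop → ∀ w,
      (∀ v, Tendsto (fun t => inner ℝ (x t) v) U (𝓝 (inner ℝ w v))) → w ∈ S) :
    ∃ w ∈ S, ConvergesWeakly x w := by
  obtain ⟨w, hw⟩ := (Ultrafilter.of (atTop : Filter ℝ)).exists_tendsto_inner
    ((Ultrafilter.of_le atTop) hC)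
  have hwS := hS _ (Ultrafilter.of_le _) w hw
  refine ⟨w, hwS, convergesWeakly_iff_inner.2 fun v => ?_⟩
  rw [tendsto_iff_ultrafilter]
  intro U hU
  obtain ⟨w', hw'⟩ := U.exists_tendsto_inner (hU hC)
  obtain ⟨l, hl⟩ := hlim w hwS
  obtain ⟨l', hl'⟩ := hlim w' (hS U hU w' hw')
  -- `‖x - w'‖² - ‖x - w‖²` is affine in `x`, so `⟨x, w - w'⟩` converges along all of `atTop`, and
  -- its limits along the two ultrafilters agree.
  have hdiff : Tendsto (fun t => inner ℝ (x t) (w - w')) atTop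
      (𝓝 ((l' - l + (‖w‖ ^ 2 - ‖w'‖ ^ 2)) / 2)) := by
    refine (((hl'.sub hl).add_const (‖w‖ ^ 2 - ‖w'‖ ^ 2)).div_const 2).congr fun t => ?_
    rw [norm_sub_sq_real, norm_sub_sq_real, inner_sub_right]
    ring
  have h1 := tendsto_nhds_unique (hw (w - w')) (hdiff.mono_left (Ultrafilter.of_le _))
  have h2 := tendsto_nhds_unique (hw' (w - w')) (hdiff.mono_left hU)
  have h3 : inner ℝ (w - w') (w - w') = 0 := by
    rw [inner_sub_left, h1, h2, sub_self]
  rw [sub_eq_zero.1 (inner_self_eq_zero.1 h3)]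
  exact hw' v

theorem ConvergesWeakly.of_tendsto_norm_sub {H : Type*} [NormedAddCommGroup H]
    [InnerProductSpace ℝ H] [CompleteSpace H] {x z : ℝ → H} {w : H} (hx : ConvergesWeakly x w)
    (h : Tendsto (fun t => ‖x t - z t‖) atTop (𝓝 0)) : ConvergesWeakly z w := by
  rw [convergesWeakly_iff_inner] at hx ⊢
  intro v
  have h1 := (hx v).sub ((tendsto_zero_iff_norm_tendsto_zero.2 h).inner (𝕜 := ℝ)
    (tendsto_const_nhds (x := v)))
  simpa [inner_sub_left] using h1

theorem theorem4p5 {H : Type*} [NormedAddCommGroup H] [InnerProductSpace ℝ H] [CompleteSpace H]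
    (A : SetValuedOp H) (hA : SetValuedOp.IsMaximallyMonotone A)
    (β : ℝ) (hβ : 0 < β)
    (B : H → H) (hBmono : SetValuedOp.IsMonotone (SetValuedOp.ofFun B))
    (hBlip : ∀ x y : H, ‖B x - B y‖ ≤ 1 / β * ‖x - y‖)
    (hzer : (SetValuedOp.zer (SetValuedOp.sum A (SetValuedOp.ofFun B))).Nonempty)
    (γ : ℝ → ℝ) (hγac : IsLocallyAbsolutelyContinuous γ)
    (δ ε : ℝ) (hδ : 0 < δ) (hε : 0 < ε)
    (hγ : ∀ t : ℝ, 0 ≤ t → δ ≤ γ t ∧ γ t ≤ β - ε)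
    (hγ' : MemLp (deriv γ) ⊤ (volume.restrict (Set.Ici (0 : ℝ))))
    (x₀ : H) (x z : ℝ → H) (hsol : IsStrongGlobalSolution A B γ x₀ x z) :
    ∃ w ∈ SetValuedOp.zer (SetValuedOp.sum A (SetValuedOp.ofFun B)),
      ConvergesWeakly x w ∧ ConvergesWeakly z w := by
  have hγB : ∀ t, 0 ≤ t → ∀ y y' : H, ‖γ t • (B y - B y')‖ ≤ ‖y - y'‖ := fun t ht y y' => by
    have h1 := hγ t ht
    rw [norm_smul, Real.norm_of_nonneg (hδ.le.trans h1.1)]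
    calc γ t * ‖B y - B y'‖ ≤ β * (1 / β * ‖y - y'‖) := by
          gcongr
          · linarith
          · exact hBlip y y'
      _ = ‖y - y'‖ := by field_simp
  have hres : ∀ t, ∃ a, 0 ≤ t → a ∈ A (z t) ∧ x t - γ t • B (x t) = z t + γ t • a := fun t => by
    by_cases ht : 0 ≤ t
    · have : z t ∈ SetValuedOp.resolvent (γ t) A (x t - γ t • B (x t)) := by
        rw [hsol.resolvent_eq t ht]; rfl
      obtain ⟨a, ha⟩ := SetValuedOp.mem_resolvent_iff.1 this
      exact ⟨a, fun _ => ha⟩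
    · exact ⟨0, fun h => absurd h ht⟩
  choose u hu using hres
  have heq : ∀ᵐ t, 0 ≤ t →
      HasDerivAt x (z t - x t + γ t • B (x t) - γ t • B (z t)) t := by
    have := (ae_restrict_iff' measurableSet_Ici).1 hsol.equation
    filter_upwards [this] with t ht ht0
    obtain ⟨v, hv, hv'⟩ := ht ht0
    convert hv using 1
    rw [← sub_eq_zero, ← neg_eq_zero, ← hv']
    abel
  have hac := hsol.locallyAC
  have hV : ∀ w, -B w ∈ A w → ∀ᵐ t, 0 ≤ t →
      deriv (fun t => ‖x t - w‖ ^ 2) t ≤ -(2 * (ε / β)) * ‖x t - z t‖ ^ 2 := fun w hw => by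
    filter_upwards [heq] with t ht ht0
    obtain ⟨h1, h2⟩ := hu t ht0
    have h3 := hA.1.inner_forwardBackwardForward_le hBmono hβ hBlip
      (hδ.le.trans (hγ t ht0).1) (hγ t ht0).2 h1 h2 hw
    rw [((ht ht0).sub_const w).norm_sq.deriv]
    linarith
  have hV0 : ∀ w, -B w ∈ A w → ∀ᵐ t, 0 ≤ t → deriv (fun t => ‖x t - w‖ ^ 2) t ≤ 0 :=
    fun w hw => by
      filter_upwards [hV w hw] with t ht ht0
      have : 0 ≤ 2 * (ε / β) * ‖x t - z t‖ ^ 2 := by positivity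
      linarith [ht ht0]
  obtain ⟨w₀, hw₀⟩ := hzer
  rw [SetValuedOp.mem_zer_sum_ofFun_iff] at hw₀
  set R := ‖x 0 - w₀‖ with hR
  have hR0 : 0 ≤ R := norm_nonneg _
  have hxR : ∀ t, 0 ≤ t → ‖x t - w₀‖ ≤ R := fun t ht =>
    le_of_sq_le_sq ((hac.norm_sub_sq w₀).antitoneOn_of_ae_deriv_nonpos (hV0 w₀ hw₀)
      Set.self_mem_Ici ht ht) hR0
  have hzR : ∀ t, 0 ≤ t → ‖z t - w₀‖ ≤ 2 * R := fun t ht => by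
    -- `w₀` is the resolvent of `w₀ - γ t • B w₀`, so `z t` can be compared with it; `γ t • B` is
    -- nonexpansive, whence the factor 2.
    have h1 := hA.1.norm_sub_le_of_add_smul (c' := γ t) (hδ.le.trans (hγ t ht).1) (hu t ht).1 hw₀
      (hu t ht).2 rfl
    have h2 : x t - γ t • B (x t) - (w₀ + γ t • -B w₀) =
        (x t - w₀) - γ t • (B (x t) - B w₀) := by
      rw [smul_sub, smul_neg]; abel
    rw [sub_self, abs_zero, zero_mul, add_zero, h2] at h1
    linarith [norm_sub_le (x t - w₀) (γ t • (B (x t) - B w₀)), hγB t ht (x t) w₀, hxR t ht]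
  have hxz : ∀ t, 0 ≤ t → ‖x t - z t‖ ≤ 3 * R := fun t ht => by
    have := norm_sub_le_norm_sub_add_norm_sub (x t) w₀ (z t)
    rw [norm_sub_rev w₀] at this
    linarith [hxR t ht, hzR t ht]
  set b := R / β + ‖B w₀‖ with hb
  have hb0 : 0 ≤ b := by positivity
  have hBx : ∀ t, 0 ≤ t → ‖B (x t)‖ ≤ b := fun t ht => by
    have h1 := hBlip (x t) w₀
    have h2 : 1 / β * ‖x t - w₀‖ ≤ R / β := by
      rw [one_div_mul_eq_div]
      gcongr
      exact hxR t ht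
    linarith [norm_le_norm_sub_add (B (x t)) (B w₀)]
  set D := (3 * R + β * b) / δ with hD
  have hD0 : 0 ≤ D := by positivity
  have huD : ∀ t, 0 ≤ t → ‖u t‖ ≤ D := fun t ht => by
    rw [hD, le_div_iff₀ hδ]
    have hγt := hγ t ht
    have h1 : γ t • u t = (x t - z t) - γ t • B (x t) := by
      rw [sub_right_comm, (hu t ht).2]; abel
    have h2 : ‖γ t • u t‖ ≤ ‖x t - z t‖ + ‖γ t • B (x t)‖ := h1 ▸ norm_sub_le _ _
    rw [norm_smul, norm_smul, Real.norm_of_nonneg (hδ.le.trans hγt.1)] at h2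
    have h3 : γ t * ‖B (x t)‖ ≤ β * b := by
      gcongr
      · linarith
      · exact hBx t ht
    have h4 : δ * ‖u t‖ ≤ γ t * ‖u t‖ := by
      gcongr
      exact hγt.1
    linarith [hxz t ht]
  obtain ⟨M, hM0, hM⟩ := hγac.exists_abs_sub_le_of_memLp_top hγ'
  have hxL : ∀ s t, 0 ≤ s → s ≤ t → ‖x t - x s‖ ≤ 6 * R * (t - s) := fun s t hs hst => by
    refine hac.norm_sub_le_of_ae_hasDerivAt hs hst ?_
    filter_upwards [heq] with r hr hrs
    have hr0 := hs.trans hrs.1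
    refine ⟨_, hr hr0, ?_⟩
    have h1 : z r - x r + γ r • B (x r) - γ r • B (z r) =
        γ r • (B (x r) - B (z r)) - (x r - z r) := by
      rw [smul_sub]; abel
    rw [h1]
    linarith [norm_sub_le (γ r • (B (x r) - B (z r))) (x r - z r), hγB r hr0 (x r) (z r),
      hxz r hr0]
  -- `12 * R` is the motion of `x` and of `γ • B x`; `M * b` and `M * D` come from the variation of
  -- `γ` in the argument and in the resolvent.
  have hzL : ∀ s t, 0 ≤ s → s ≤ t → ‖z t - z s‖ ≤ (12 * R + M * b + M * D) * (t - s) :=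
    fun s t hs hst => by
      have ht := hs.trans hst
      have h1 := hA.1.norm_sub_le_of_add_smul (hδ.le.trans (hγ t ht).1) (hu t ht).1 (hu s hs).1
        (hu t ht).2 (hu s hs).2
      have h2 : x t - γ t • B (x t) - (x s - γ s • B (x s)) =
          (x t - x s) - γ t • (B (x t) - B (x s)) - (γ t - γ s) • B (x s) := by
        rw [smul_sub, sub_smul]; abel
      have h3 : ‖(γ t - γ s) • B (x s)‖ ≤ M * (t - s) * b := by
        rw [norm_smul]
        exact mul_le_mul (hM s t hs hst) (hBx s hs) (norm_nonneg _)
          ((abs_nonneg _).trans (hM s t hs hst))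
      have h4 : |γ s - γ t| * ‖u s‖ ≤ M * (t - s) * D := by
        rw [abs_sub_comm]
        exact mul_le_mul (hM s t hs hst) (huD s hs) (norm_nonneg _)
          ((abs_nonneg _).trans (hM s t hs hst))
      rw [h2] at h1
      have h5 := norm_sub_le ((x t - x s) - γ t • (B (x t) - B (x s))) ((γ t - γ s) • B (x s))
      have h6 := norm_sub_le (x t - x s) (γ t • (B (x t) - B (x s)))
      have h7 := hγB t ht (x t) (x s)
      have h8 := hxL s t hs hst
      linarith
  have hlim0 : Tendsto (fun t => ‖x t - z t‖) atTop (𝓝 0) := by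
    refine tendsto_zero_of_ae_deriv_le_neg_sq (g := fun t => ‖x t - w₀‖ ^ 2) (c := 2 * (ε / β))
      -- The `+ 1` keeps `L` positive even when `R = 0`.
      (L := 18 * R + M * b + M * D + 1) (by positivity) (by positivity) (hac.norm_sub_sq w₀)
      (fun t => sq_nonneg _) (fun t => norm_nonneg _) (fun s t hs hst => ?_) (hV w₀ hw₀)
    have h1 := norm_sub_norm_le (x s - z s) (x t - z t)
    have h2 : x s - z s - (x t - z t) = (z t - z s) - (x t - x s) := by abel
    rw [h2] at h1
    linarith [norm_sub_le (z t - z s) (x t - x s), hxL s t hs hst, hzL s t hs hst]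
  have hrlim : Tendsto (fun t => u t + B (z t)) atTop (𝓝 0) := by
    refine squeeze_zero_norm' (a := fun t => (1 / δ + 1 / β) * ‖x t - z t‖) ?_
      (by simpa using hlim0.const_mul (1 / δ + 1 / β))
    filter_upwards [eventually_ge_atTop 0] with t ht
    have hγt := (hγ t ht).1
    have hγ0 : 0 < γ t := hδ.trans_le hγt
    have h1 : u t + B (z t) = (γ t)⁻¹ • (x t - z t) - (B (x t) - B (z t)) := by
      have h2 : x t - z t = γ t • (u t + B (x t)) := by
        rw [smul_add, ← sub_eq_iff_eq_add, sub_right_comm, (hu t ht).2]; abel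
      rw [h2, inv_smul_smul₀ hγ0.ne']; abel
    have h3 : ‖(γ t)⁻¹ • (x t - z t)‖ ≤ 1 / δ * ‖x t - z t‖ := by
      rw [norm_smul, norm_inv, Real.norm_of_nonneg hγ0.le, ← one_div]
      gcongr
    rw [h1]
    linarith [norm_sub_le ((γ t)⁻¹ • (x t - z t)) (B (x t) - B (z t)), hBlip (x t) (z t)]
  have hbd : ∀ {y w : H} {r : ℝ}, ‖y - w‖ ≤ r → ‖y‖ ≤ r + ‖w‖ := fun {y w r} h => by
    linarith [norm_le_norm_sub_add y w]
  obtain ⟨w, hw, hxw⟩ := exists_convergesWeakly_of_tendsto_norm_sub (x := x)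
    (S := {w | -B w ∈ A w}) (C := R + ‖w₀‖)
    (by filter_upwards [eventually_ge_atTop 0] with t ht using hbd (hxR t ht))
    (fun w hw => (hac.norm_sub_sq w).exists_tendsto_of_ae_deriv_nonpos (fun t => sq_nonneg _)
      (hV0 w hw))
    -- Closedness is applied to `z`, which has the same weak limit as `x` since `x - z → 0`.
    (fun U hU w hw => by
      refine hA.neg_mem_of_tendsto hBmono hβ hBlip U (z := z) (u := u) (C := 2 * R + ‖w₀‖)
        (hU ?_) (hU ?_) (fun v => ?_) (hrlim.mono_left hU)
      · filter_upwards [eventually_ge_atTop 0] with t ht using (hu t ht).1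
      · filter_upwards [eventually_ge_atTop 0] with t ht using hbd (hzR t ht)
      · have h1 := (hw v).sub (((tendsto_zero_iff_norm_tendsto_zero.2 hlim0).mono_left hU).inner
          (𝕜 := ℝ) (tendsto_const_nhds (x := v)))
        simpa [inner_sub_left] using h1)
  exact ⟨w, SetValuedOp.mem_zer_sum_ofFun_iff.2 hw, hxw, hxw.of_tendsto_norm_sub hlim0⟩
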